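/- Let $m\ge 1$, $n\ge 1$, let $\mathbf H=[\mathbf h_1,\dots,\mathbf h_n]\in\mathbb R^{m\times n}$ have linearly independent columns, let $\mathbf H=\mathbf Q\mathbf R$ be a QR factorization ($\mathbf Q^\top\mathbf Q=\mathbf I$, $\mathbf R$ upper triangular), and let $\mathbf y\in\mathbb R^m$. Let $\lfloor\cdot\rceil$ denote rounding to the nearest integer, $\|\cdot\|$ the Euclidean norm, $\mathcal L(\cdot)$ the set of integer combinations, and let $\pi_i$ and $\pi_i^\perp$ be the orthogonal projections onto $\mathrm{span}(\mathbf h_1,\dots,\mathbf h_{i-1})$ and onto its orthogonal complement. Put $\bar{\mathbf y}=\mathbf Q^\top\mathbf y$. The SIC estimate $\mathbf x^{\mathrm{sic}}\in\mathbb Z^n$ is given, for $k=n,n-1,\dots,1$, by $$x^{\mathrm{sic}}_k=\Big\lfloor \Big(\bar y_k-\sum_{j>k}R_{k,j}x^{\mathrm{sic}}_j\Big)/R_{k,k}\Big\rceil .$$ Then a minimizer $\mathbf x^{\mathrm{cvp}}$ of $\|\mathbf y-\mathbf H\mathbf x\|$ over $\mathbf x\in\mathbb Z^n$ exists, and for every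 such minimizer $$\|\mathbf y-\mathbf H\mathbf x^{\mathrm{sic}}\|\le\eta_n\,\|\mathbf y-\mathbf H\mathbf x^{\mathrm{cvp}}\|$$ holds in each of the following two cases. (1) $\mathbf H$ is boosted LLL reduced with Lovász constant $\delta\in(1/4,1)$, and $$\eta_n=\frac{\beta^n}{\sqrt{\beta^2-1}},\qquad \beta=\frac1{\sqrt{\delta-1/4}}\in(2/\sqrt3,\infty).$$ Boosted LLL reduced means that $\delta R_{i,i}^2\le (R_{i,i+1}-\lfloor R_{i,i+1}/R_{i,i}\rceil R_{i,i})^2+R_{i+1,i+1}^2$ for $1\le i\le n-1$, and that each $\mathbf h_i$, $2\le i\le n$, is reduced by an approximate closest vector oracle with list size $p$ and rejection: for some vector $\mathbf g$, $\mathbf h_i$ is a shortest vector among $\mathbf g$ and the vectors $\mathbf g-\mathbf v$, where $\mathbf v$ runs over a list of at most $p$ elements of $\mathcal L(\mathbf h_1,\dots,\mathbf h_{i-1})$ that the oracle returns for $\mathbf g$. The oracle and $p$ are arbitrary. (2) $\mathbf H$ is boosted KZ reduced, and $$\eta_n=1+\frac{8n}{9}(n-1)^{1+\ln(n-1)/2},$$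 to be read as $\eta_1=1$ for $n=1$. Boosted KZ reduced means that for $1\le i\le n$ the vector $\pi_i^\perp(\mathbf h_i)$ is a shortest nonzero vector of the lattice $\mathcal L(\pi_i^\perp(\mathbf h_i),\dots,\pi_i^\perp(\mathbf h_n))$, and that for $2\le i\le n$ one has $\|\mathbf h_i\|\le\|\mathbf h_i-\mathbf q_i\|$, where $\mathbf q_i$ is a point of $\mathcal L(\mathbf h_1,\dots,\mathbf h_{i-1})$ nearest to $\pi_i(\mathbf h_i)$. -/

import Mathlib

noncomputable section

/-- The `i`-th column `h_i` of `H`, as a vector of Euclidean space. -/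
def column {m n : ℕ} (H : Matrix (Fin m) (Fin n) ℝ) (i : Fin n) : EuclideanSpace ℝ (Fin m) :=
  WithLp.toLp 2 (fun a => H a i)

/-- The columns of `H` strictly before the `i`-th one, `h_1, …, h_{i-1}`. -/
def precedingColumns {m n : ℕ} (H : Matrix (Fin m) (Fin n) ℝ) (i : Fin n) :
    Fin i.val → EuclideanSpace ℝ (Fin m) :=
  fun j => column H (Fin.castLE i.isLt.le j)

/-- `H` is a lattice basis: its columns are linearly independent over `ℝ`. -/
def IsLatticeBasis {m n : ℕ} (H : Matrix (Fin m) (Fin n) ℝ) : Prop :=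
  LinearIndependent ℝ (column H)

/-- The set of integer combinations of a family of vectors. -/
def latticeOf {m : ℕ} {ι : Type} (b : ι → EuclideanSpace ℝ (Fin m)) :
    Submodule ℤ (EuclideanSpace ℝ (Fin m)) :=
  Submodule.span ℤ (Set.range b)

/-- The lattice point `H x` with integer coefficient vector `x`. -/
def latticePoint {m n : ℕ} (H : Matrix (Fin m) (Fin n) ℝ) (x : Fin n → ℤ) :
    EuclideanSpace ℝ (Fin m) :=
  WithLp.toLp 2 (H.mulVec (fun i => (x i : ℝ)))

/-- `H = Q R` with orthonormal columns of `Q` and upper triangular `R`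
(the signs of the diagonal entries of `R` are not normalized). -/
structure IsQR {m n : ℕ} (H Q : Matrix (Fin m) (Fin n) ℝ) (R : Matrix (Fin n) (Fin n) ℝ) :
    Prop where
  orthonormal : Q.transpose * Q = 1
  upper : ∀ i j : Fin n, j < i → R i j = 0
  factor : H = Q * R

/-! ### Closest vectors and SIC -/

/-- `x` minimizes `‖y - H x‖` over all integer vectors. -/
def IsCVP {m n : ℕ} (H : Matrix (Fin m) (Fin n) ℝ) (y : EuclideanSpace ℝ (Fin m))
    (x : Fin n → ℤ) : Prop :=
  ∀ z : Fin n → ℤ, ‖y - latticePoint H x‖ ≤ ‖y - latticePoint H z‖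

/-- `xhat` solves the `η`-approximate closest vector problem for `(H, y)`: closest vectors exist,
and `‖y - H xhat‖ ≤ η ‖y - H xcvp‖` for each of them. -/
def SolvesApproxCVP {m n : ℕ} (η : ℝ) (H : Matrix (Fin m) (Fin n) ℝ)
    (y : EuclideanSpace ℝ (Fin m)) (xhat : Fin n → ℤ) : Prop :=
  (∃ xcvp : Fin n → ℤ, IsCVP H y xcvp) ∧
    ∀ xcvp : Fin n → ℤ, IsCVP H y xcvp →
      ‖y - latticePoint H xhat‖ ≤ η * ‖y - latticePoint H xcvp‖

/-- Back substitution with rounding, from the last coordinate down to the first: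
`x_k = round ((ybar_k - ∑_{j > k} R_{k,j} x_j) / R_{k,k})`. -/
def sicCoord {n : ℕ} (R : Matrix (Fin n) (Fin n) ℝ) (ybar : Fin n → ℝ) (k : Fin n) : ℤ :=
  round ((ybar k - ∑ j : {j : Fin n // k < j}, R k j.val * (sicCoord R ybar j.val : ℝ)) / R k k)
termination_by n - k.val
decreasing_by
  have h1 : k.val < j.val.val := j.property
  omega

/-- The successive interference cancellation estimate: back substitution with rounding, applied
to `ybar = Qᵀ y`. -/
def sic {m n : ℕ} (Q : Matrix (Fin m) (Fin n) ℝ) (R : Matrix (Fin n) (Fin n) ℝ)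
    (y : EuclideanSpace ℝ (Fin m)) : Fin n → ℤ :=
  fun k => sicCoord R (Q.transpose.mulVec (fun a => y a)) k

/-! ### Boosted LLL reduction -/

/-- An approximate closest vector oracle with list size `p`: given a family `b` and a target `t`,
it returns at most `p` candidate vectors of the lattice generated by `b`. No quality of the
candidates is required. -/
structure ApproxCVPOracle (m p : ℕ) where
  candidates : (k : ℕ) → (Fin k → EuclideanSpace ℝ (Fin m)) → EuclideanSpace ℝ (Fin m) →
    Finset (EuclideanSpace ℝ (Fin m))
  mem_lattice : ∀ (k : ℕ) (b : Fin k → EuclideanSpace ℝ (Fin m)) (t : EuclideanSpace ℝ (Fin m)),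
    ∀ v ∈ candidates k b t, v ∈ latticeOf b
  card_le : ∀ (k : ℕ) (b : Fin k → EuclideanSpace ℝ (Fin m)) (t : EuclideanSpace ℝ (Fin m)),
    (candidates k b t).card ≤ p

/-- `h` is the outcome of reducing `g` against the family `b` by the oracle with rejection:
`h` is a shortest vector among `g` and all `g - v`, `v` a candidate
(so that `g` itself is kept when no candidate makes it shorter). -/
def IsOracleReduction {m p : ℕ} (O : ApproxCVPOracle m p) {k : ℕ}
    (b : Fin k → EuclideanSpace ℝ (Fin m)) (g h : EuclideanSpace ℝ (Fin m)) : Prop :=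
  (h = g ∨ ∃ v ∈ O.candidates k b g, h = g - v) ∧
    ‖h‖ ≤ ‖g‖ ∧ ∀ v ∈ O.candidates k b g, ‖h‖ ≤ ‖g - v‖

/-- `H`, with R-factor `R`, is boosted LLL reduced with Lovász constant `δ` and oracle `O`. -/
structure IsBoostedLLL {m n p : ℕ} (δ : ℝ) (O : ApproxCVPOracle m p)
    (H : Matrix (Fin m) (Fin n) ℝ) (R : Matrix (Fin n) (Fin n) ℝ) : Prop where
  diagonal : ∀ i j : Fin n, j.val = i.val + 1 →
    δ * R i i ^ 2 ≤ (R i j - (round (R i j / R i i) : ℝ) * R i i) ^ 2 + R j j ^ 2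
  length : ∀ i : Fin n, 0 < i.val →
    ∃ g : EuclideanSpace ℝ (Fin m), IsOracleReduction O (precedingColumns H i) g (column H i)

/-- `β = 1 / √(δ - 1/4)`. -/
def lovaszBeta (δ : ℝ) : ℝ := 1 / Real.sqrt (δ - 1 / 4)

/-! ### Boosted KZ reduction -/

/-- The real span of `h_1, …, h_{i-1}`. -/
def precedingSpan {m n : ℕ} (H : Matrix (Fin m) (Fin n) ℝ) (i : Fin n) :
    Submodule ℝ (EuclideanSpace ℝ (Fin m)) :=
  Submodule.span ℝ (Set.range (precedingColumns H i))

/-- The projection of `h_j` onto the orthogonal complement of `span (h_1, …, h_{i-1})`. -/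
def projectedColumn {m n : ℕ} (H : Matrix (Fin m) (Fin n) ℝ) (i j : Fin n) :
    EuclideanSpace ℝ (Fin m) :=
  (precedingSpan H i)ᗮ.starProjection (column H j)

/-- `v` is a shortest nonzero vector of `L`. -/
def IsShortestVector {m : ℕ} (L : Submodule ℤ (EuclideanSpace ℝ (Fin m)))
    (v : EuclideanSpace ℝ (Fin m)) : Prop :=
  v ∈ L ∧ v ≠ 0 ∧ ∀ w ∈ L, w ≠ 0 → ‖v‖ ≤ ‖w‖

/-- `v` is a point of `L` nearest to `t`. -/
def IsNearestPoint {m : ℕ} (L : Submodule ℤ (EuclideanSpace ℝ (Fin m)))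
    (t v : EuclideanSpace ℝ (Fin m)) : Prop :=
  v ∈ L ∧ ∀ w ∈ L, ‖t - v‖ ≤ ‖t - w‖

/-- `H` is boosted KZ reduced. In `length`, all points nearest to the projection of `h_i` are at
the same distance from `h_i`, so it does not matter which one the quantizer picks. -/
structure IsBoostedKZ {m n : ℕ} (H : Matrix (Fin m) (Fin n) ℝ) : Prop where
  projection : ∀ i : Fin n,
    IsShortestVector (latticeOf (fun j : {j : Fin n // i ≤ j} => projectedColumn H i j.val))
      (projectedColumn H i i)
  length : ∀ i : Fin n, 0 < i.val →
    ∀ v : EuclideanSpace ℝ (Fin m),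
      IsNearestPoint (latticeOf (precedingColumns H i))
        ((precedingSpan H i).starProjection (column H i)) v →
      ‖column H i‖ ≤ ‖column H i - v‖

/-! ### The two factors -/

/-- `β ^ n / √(β² - 1)` for the `β` of the Lovász constant `δ`. -/
def etaBoostedLLL (δ : ℝ) (n : ℕ) : ℝ :=
  lovaszBeta δ ^ n / Real.sqrt (lovaszBeta δ ^ 2 - 1)

/-- `1 + (8n/9) (n-1)^{1 + ln(n-1)/2}`, which is read as `1` for `n = 1`. -/
def etaBoostedKZ (n : ℕ) : ℝ :=
  if n = 1 then 1
  else 1 + (8 * (n : ℝ) / 9) * ((n : ℝ) - 1) ^ (1 + Real.log ((n : ℝ) - 1) / 2)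

end

/-! ### Orthonormal coordinates and existence of closest vectors -/

section

open Matrix

/-! Both cases reduce to one condition on the diagonal of `R`: if `∑ i ≤ k, R i i ^ 2 ≤ c ^ 2 * R k
k ^ 2` for every `k` and `c ≥ 1`, then back substitution with rounding is `c`-approximate
(`norm_sub_sic_le`). Compare the SIC point with any other integer vector at the last index `k` where
they differ. Beyond `k` the residuals agree; at `k` the competitor pays at least `|R k k| / 2`; at
each `i ≤ k` SIC pays at most `|R i i| / 2`.

For LLL, the Lovász condition gives `R i i ^ 2 ≤ β ^ 2 * R (i+1) (i+1) ^ 2`, so the sum over `i ≤ k`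
is dominated by a geometric series.

For KZ, Minkowski's linear forms theorem on the diagonal block from `i` to `k` bounds `R i i ^ 2` by
the block size times the geometric mean of the squared diagonal entries
(`IsBoostedKZ.diag_sq_pow_le`). Read backwards from `k` and normalized, this is the recursion `b t ^
(t+1) ≤ (t+1) ^ (t+1) * ∏ s ≤ t, b s` with `b 0 = 1`. Taking logarithms solves it as `b t ≤ (t+1) *
∏ s ∈ [1, t], (s+1) ^ (1/s)`, and elementary estimates of the product and of the sum over `t` give
the stated factor. -/

theorem Matrix.dotProduct_self_sub_mulVec {m n : ℕ} {Q : Matrix (Fin m) (Fin n) ℝ}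
    (hQ : Qᵀ * Q = 1) (y : Fin m → ℝ) (c : Fin n → ℝ) :
    (y - Q *ᵥ c) ⬝ᵥ (y - Q *ᵥ c) =
      (y - Q *ᵥ (Qᵀ *ᵥ y)) ⬝ᵥ (y - Q *ᵥ (Qᵀ *ᵥ y)) + (Qᵀ *ᵥ y - c) ⬝ᵥ (Qᵀ *ᵥ y - c) := by
  have hortho : ∀ d : Fin n → ℝ, (y - Q *ᵥ (Qᵀ *ᵥ y)) ⬝ᵥ (Q *ᵥ d) = 0 := by
    intro d
    rw [dotProduct_mulVec, ← mulVec_transpose, mulVec_sub, mulVec_mulVec, hQ, one_mulVec]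
    simp
  have hisom : ∀ d : Fin n → ℝ, (Q *ᵥ d) ⬝ᵥ (Q *ᵥ d) = d ⬝ᵥ d := by
    intro d
    rw [dotProduct_mulVec, ← mulVec_transpose, mulVec_mulVec, hQ, one_mulVec]
  have hsplit : y - Q *ᵥ c = (y - Q *ᵥ (Qᵀ *ᵥ y)) + Q *ᵥ (Qᵀ *ᵥ y - c) := by
    rw [mulVec_sub]; abel
  rw [hsplit, add_dotProduct, dotProduct_add, dotProduct_add, hortho, hisom,
    dotProduct_comm (Q *ᵥ _), hortho]
  ring

theorem norm_sq_toLp {m : ℕ} (v : Fin m → ℝ) : ‖WithLp.toLp 2 v‖ ^ 2 = v ⬝ᵥ v := by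
  rw [EuclideanSpace.norm_sq_eq]
  simp [dotProduct, sq]

theorem norm_sq_toLp_mulVec {m n : ℕ} {Q : Matrix (Fin m) (Fin n) ℝ} (hQ : Qᵀ * Q = 1)
    (c : Fin n → ℝ) : ‖WithLp.toLp 2 (Q *ᵥ c)‖ ^ 2 = ∑ k, c k ^ 2 := by
  rw [norm_sq_toLp, dotProduct_mulVec, ← mulVec_transpose, mulVec_mulVec, hQ, one_mulVec]
  simp [dotProduct, sq]

theorem norm_sq_sub_latticePoint {m n : ℕ} {H Q : Matrix (Fin m) (Fin n) ℝ}
    {R : Matrix (Fin n) (Fin n) ℝ} (hQR : IsQR H Q R) (y : EuclideanSpace ℝ (Fin m))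
    (x : Fin n → ℤ) :
    ‖y - latticePoint H x‖ ^ 2 =
      ‖y - WithLp.toLp 2 (Q *ᵥ (Qᵀ *ᵥ y.ofLp))‖ ^ 2 +
        ∑ k, ((Qᵀ *ᵥ y.ofLp) k - (R *ᵥ fun i => (x i : ℝ)) k) ^ 2 := by
  have h := dotProduct_self_sub_mulVec hQR.orthonormal y.ofLp (R *ᵥ fun i => (x i : ℝ))
  rw [mulVec_mulVec, ← hQR.factor] at h
  have e : ∀ w : Fin m → ℝ, ‖y - WithLp.toLp 2 w‖ ^ 2 = (y.ofLp - w) ⬝ᵥ (y.ofLp - w) := by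
    intro w
    rw [← norm_sq_toLp]; rfl
  rw [latticePoint, e, e, h]
  congr 1
  simp [dotProduct, sq]

theorem latticePoint_eq_sum {m n : ℕ} (H : Matrix (Fin m) (Fin n) ℝ) (x : Fin n → ℤ) :
    latticePoint H x = ∑ i, (x i : ℝ) • column H i := by
  ext a
  simp [latticePoint, column, mulVec, dotProduct, mul_comm]

/-- The diagonal of the R-factor of a lattice basis does not vanish. -/
theorem IsQR.diag_ne_zero {m n : ℕ} {H Q : Matrix (Fin m) (Fin n) ℝ}
    {R : Matrix (Fin n) (Fin n) ℝ} (hQR : IsQR H Q R) (hH : IsLatticeBasis H) (i : Fin n) :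
    R i i ≠ 0 := by
  have hdet : R.det ≠ 0 := by
    intro h0
    obtain ⟨v, hv, hv0⟩ := exists_mulVec_eq_zero_iff.mpr h0
    apply hv
    have h := Fintype.linearIndependent_iff.mp hH v (by
      ext a
      have : (H *ᵥ v) a = 0 := by rw [hQR.factor, ← mulVec_mulVec, hv0, mulVec_zero]; rfl
      simpa [column, mulVec, dotProduct, mul_comm] using this)
    funext i; exact h i
  rw [det_of_isUpperTriangular (fun i j h => hQR.upper i j h)] at hdet
  exact Finset.prod_ne_zero_iff.mp hdet i (Finset.mem_univ i)

/-- By independence, `x ↦ H x` is a closed embedding of `ℤⁿ`, so the distance to `y` tends to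
infinity along the cofinite filter and attains its minimum. -/
theorem exists_isCVP {m n : ℕ} {H : Matrix (Fin m) (Fin n) ℝ} (hH : IsLatticeBasis H)
    (y : EuclideanSpace ℝ (Fin m)) : ∃ x, IsCVP H y x := by
  have h1 : Topology.IsClosedEmbedding (fun (x : Fin n → ℤ) (i : Fin n) => (x i : ℝ)) :=
    Topology.IsClosedEmbedding.piMap fun _ => Int.isClosedEmbedding_coe_real
  have h2 := LinearMap.isClosedEmbedding_of_injective
    (f := Fintype.linearCombination ℝ (column H)) (LinearMap.ker_eq_bot.mpr
      (linearIndependent_iff_injective_fintypeLinearCombination.mp hH))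
  have h3 := (h2.comp h1).tendsto_cocompact
  rw [Filter.cocompact_eq_cofinite] at h3
  have h4 : Filter.Tendsto (fun z : EuclideanSpace ℝ (Fin m) => ‖y - z‖)
      (Filter.cocompact _) Filter.atTop :=
    tendsto_norm_cocompact_atTop.comp (Homeomorph.subLeft y).isClosedEmbedding.tendsto_cocompact
  obtain ⟨x, hx⟩ := (h4.comp h3).exists_forall_le
  refine ⟨x, fun z => ?_⟩
  simpa [latticePoint_eq_sum, Fintype.linearCombination_apply] using hx z

theorem half_le_abs_sub_of_ne_round {u : ℝ} {z : ℤ} (hz : z ≠ round u) : 1 / 2 ≤ |u - z| := by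
  have h1 := abs_sub_round u
  have h2 : (1 : ℝ) ≤ |(z : ℝ) - round u| := by
    have := Int.one_le_abs (sub_ne_zero.mpr hz)
    exact_mod_cast this
  have h3 : |(z : ℝ) - round u| ≤ |u - z| + |u - round u| := by
    rw [abs_sub_comm u z]
    exact abs_sub_le _ _ _
  linarith

/-- Exhibits the `k`-th residual as `R k k` times the gap between `x k` and the number that back
substitution would round. -/
theorem sub_mulVec_eq_of_upper {n : ℕ} {R : Matrix (Fin n) (Fin n) ℝ}
    (hR : ∀ i j : Fin n, j < i → R i j = 0) (ybar x : Fin n → ℝ) (k : Fin n) (hk : R k k ≠ 0) :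
    ybar k - (R *ᵥ x) k =
      R k k * ((ybar k - ∑ j : {j : Fin n // k < j}, R k j.val * x j.val) / R k k - x k) := by
  have h : (R *ᵥ x) k = R k k * x k + ∑ j : {j : Fin n // k < j}, R k j.val * x j.val := by
    have e1 : ∑ j : {j : Fin n // k < j}, R k j.val * x j.val = ∑ j ∈ Finset.Ioi k, R k j * x j :=
      (Finset.sum_subtype _ (fun j => Finset.mem_Ioi) fun j => R k j * x j).symm
    have e2 : ∑ j ∈ Finset.Ici k, R k j * x j = (R *ᵥ x) k := by
      refine Finset.sum_subset (Finset.subset_univ _) fun j _ hj => ?_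
      rw [hR k j (by simpa using hj), zero_mul]
    rw [e1, ← e2, ← Finset.Ioi_insert, Finset.sum_insert (by simp)]
  rw [h]; field_simp; ring

end

/-! ### Minkowski's linear forms theorem -/

section

open Matrix MeasureTheory

/-- **Minkowski's linear forms theorem** for integer vectors. -/
theorem exists_int_ne_zero_abs_mulVec_le {ι : Type*} [Fintype ι] [DecidableEq ι] [Nonempty ι]
    {A : Matrix ι ι ℝ} (hA : A.det ≠ 0) {c : ℝ} (hc : 0 ≤ c)
    (hdet : |A.det| ≤ c ^ Fintype.card ι) :
    ∃ x : ι → ℤ, x ≠ 0 ∧ ∀ i, |(A *ᵥ fun j => (x j : ℝ)) i| ≤ c := by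
  have hdet' : LinearMap.det (Matrix.toLin' A) ≠ 0 := by rwa [LinearMap.det_toLin']
  have hinj : Function.Injective (Matrix.toLin' A) :=
    (LinearMap.equivOfDetNeZero _ hdet').injective
  have hvol : volume (Matrix.toLin' A ⁻¹' Metric.closedBall (0 : ι → ℝ) c) =
      ENNReal.ofReal (|A.det|⁻¹ * (2 * c) ^ Fintype.card ι) := by
    rw [Measure.addHaar_preimage_linearMap _ hdet', Real.volume_pi_closedBall _ hc,
      LinearMap.det_toLin', abs_inv, ← ENNReal.ofReal_mul (by positivity)]
  have : Countable (Submodule.span ℤ (Set.range (Pi.basisFun ℝ ι))).toAddSubgroup :=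
    inferInstanceAs (Countable (Submodule.span ℤ (Set.range (Pi.basisFun ℝ ι))))
  -- The convex body is the preimage of a cube under `A`. Its compactness allows equality in the
  -- volume condition, hence the non-strict hypothesis on the determinant.
  obtain ⟨z, hz0, hz⟩ := exists_ne_zero_mem_lattice_of_measure_mul_two_pow_le_measure
    (s := Matrix.toLin' A ⁻¹' Metric.closedBall (0 : ι → ℝ) c)
    (ZSpan.isAddFundamentalDomain' (Pi.basisFun ℝ ι) volume)
    (fun x hx => by simpa [Matrix.mulVec_neg] using hx)
    ((convex_closedBall _ _).linear_preimage _)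
    ((LinearMap.isClosedEmbedding_of_injective (LinearMap.ker_eq_bot.mpr hinj)).isCompact_preimage
      (isCompact_closedBall _ _))
    (by
      rw [hvol, ZSpan.fundamentalDomain_pi_basisFun, volume_pi, Measure.pi_pi]
      simp only [Real.volume_Ico, sub_zero, ENNReal.ofReal_one, Finset.prod_const_one, one_mul,
        Module.finrank_fintype_fun_eq_card]
      rw [← ENNReal.ofReal_ofNat, ← ENNReal.ofReal_pow (by norm_num)]
      apply ENNReal.ofReal_le_ofReal
      rw [mul_pow, ← div_eq_inv_mul, le_div_iff₀ (abs_pos.mpr hA)]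
      gcongr)
  have hint : ∀ i, ∃ k : ℤ, (k : ℝ) = (z : ι → ℝ) i := by
    intro i
    simpa using ((Pi.basisFun ℝ ι).mem_span_iff_repr_mem ℤ (z : ι → ℝ)).mp z.2 i
  choose x hx using hint
  have hxz : (fun j => (x j : ℝ)) = (z : ι → ℝ) := funext hx
  refine ⟨x, ?_, fun i => ?_⟩
  · rintro rfl
    apply hz0
    ext i
    simp [← hx i]
  · rw [hxz]
    have : ‖A *ᵥ (z : ι → ℝ)‖ ≤ c := by simpa using hz
    exact (norm_le_pi_norm _ i).trans this

end

/-! ### The recursion for KZ diagonals and its growth -/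

section

open Finset

/-- The extremal sequence, summed: exchanging the double sum on the right leaves weight `t - r` on
the `r`-th quotient, and the terms `log (s + 1)` supply the missing `r + 1`. -/
theorem add_one_mul_sum_log_div (t : ℕ) :
    (t + 1 : ℝ) * ∑ s ∈ range t, Real.log (s + 2) / (s + 1) =
      ∑ s ∈ range (t + 1),
        (Real.log (s + 1) + ∑ r ∈ range s, Real.log (r + 2) / (r + 1)) := by
  induction t with
  | zero => simp
  | succ t ih =>
    rw [sum_range_succ _ (t + 1), ← ih, sum_range_succ _ t]
    push_cast
    have : (t + 1 : ℝ) ≠ 0 := by positivity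
    have h2 : (t + 1 + 1 : ℝ) = t + 2 := by ring
    rw [h2]
    field_simp
    ring

theorem log_le_of_pow_le_prod {b : ℕ → ℝ} {N : ℕ} (hpos : ∀ t, 0 < b t) (h0 : b 0 = 1)
    (h : ∀ t ≤ N, b t ^ (t + 1) ≤ (t + 1 : ℝ) ^ (t + 1) * ∏ s ∈ range (t + 1), b s) :
    ∀ t ≤ N, Real.log (b t) ≤
      Real.log (t + 1) + ∑ s ∈ range t, Real.log (s + 2) / (s + 1) := by
  intro t
  induction t using Nat.strong_induction_on with
  | _ t ih =>
    intro ht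
    rcases t with _ | t
    · simp [h0]
    -- The product contains `b (t + 1)` itself; moving its logarithm to the left lowers the
    -- coefficient from `t + 2` to `t + 1`.
    have hlog := Real.log_le_log (pow_pos (hpos _) _) (h (t + 1) ht)
    rw [Real.log_mul (by positivity) (prod_ne_zero_iff.mpr fun s _ => (hpos s).ne'),
      Real.log_pow, Real.log_pow, Real.log_prod (fun s _ => (hpos s).ne'),
      sum_range_succ] at hlog
    have hsum : ∑ s ∈ range (t + 1), Real.log (b s) ≤ (t + 1 : ℝ) *
        ∑ s ∈ range t, Real.log (s + 2) / (s + 1) := by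
      rw [add_one_mul_sum_log_div]
      refine sum_le_sum fun s hs => ih s (mem_range.mp hs) ?_
      have := mem_range.mp hs
      omega
    rw [sum_range_succ]
    push_cast at hlog ⊢
    have h2 : (t + 1 + 1 : ℝ) = t + 2 := by ring
    rw [h2] at hlog ⊢
    have hp : (0 : ℝ) < t + 1 := by positivity
    rw [← mul_le_mul_iff_right₀ hp]
    have : (t + 1 : ℝ) * (Real.log (t + 2) + (∑ s ∈ range t, Real.log (s + 2) / (s + 1) +
        Real.log (t + 2) / (t + 1))) = (t + 2) * Real.log (t + 2) +
          (t + 1) * ∑ s ∈ range t, Real.log (s + 2) / (s + 1) := by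
      field_simp; ring
    rw [this]
    linarith

theorem inv_add_one_le_log_sub (x : ℝ) (hx : 0 < x) :
    1 / (x + 1) ≤ Real.log (x + 1) - Real.log x := by
  rw [← Real.log_div (by positivity) hx.ne']
  have := Real.one_sub_inv_le_log_of_pos (x := (x + 1) / x) (by positivity)
  refine le_trans (le_of_eq ?_) this
  field_simp; ring

theorem log_sub_le_inv (x : ℝ) (hx : 0 < x) : Real.log (x + 1) - Real.log x ≤ 1 / x := by
  rw [← Real.log_div (by positivity) hx.ne']
  refine (Real.log_le_sub_one_of_pos (by positivity)).trans (le_of_eq ?_)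
  field_simp; ring

/-- With `p, q, r` the logarithms of `t + 1, t + 2, t + 3`, the increment satisfies `r / (t+2) ≤ 1 /
(t+2)² + q / (t+2) ≤ (r - q) + (q² - p²)`, and the bound telescopes. -/
theorem sum_log_div_le (t : ℕ) : ∑ s ∈ range (t + 1), Real.log (s + 2) / (s + 1) ≤
    Real.log (t + 2) + Real.log (t + 1) ^ 2 := by
  induction t with
  | zero => simp
  | succ t ih =>
    rw [sum_range_succ]
    push_cast
    have e3 : (t + 1 + 2 : ℝ) = t + 2 + 1 := by ring
    have e2 : (t + 1 + 1 : ℝ) = t + 2 := by ring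
    rw [e3, e2]
    have a1 := inv_add_one_le_log_sub (t + 1) (by positivity)
    have a2 := inv_add_one_le_log_sub (t + 2) (by positivity)
    have a3 := log_sub_le_inv (t + 2) (by positivity)
    rw [e2] at a1
    set p := Real.log (t + 1)
    set q := Real.log (t + 2)
    set r := Real.log (t + 2 + 1)
    have hp : 0 ≤ p := Real.log_nonneg (by linarith [Nat.cast_nonneg (α := ℝ) t])
    have hq : 0 ≤ q := Real.log_nonneg (by linarith [Nat.cast_nonneg (α := ℝ) t])
    have a4 : 1 / (t + 2 : ℝ) * (p + q) ≤ q ^ 2 - p ^ 2 := by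
      calc _ ≤ (q - p) * (p + q) := by gcongr
        _ = _ := by ring
    have a5 : r / (t + 2) ≤ 1 / (t + 2) * (1 / (t + 2) + q) := by
      rw [div_eq_mul_one_div, mul_comm]
      gcongr
      linarith
    have a6 : 1 / (t + 2 : ℝ) * (1 / (t + 2)) ≤ 1 / (t + 2 + 1) := by
      rw [one_div_mul_one_div]
      apply one_div_le_one_div_of_le (by positivity)
      nlinarith [Nat.cast_nonneg (α := ℝ) t]
    have a7 : 0 ≤ 1 / (t + 2 : ℝ) * p := by positivity
    nlinarith

theorem le_of_pow_le_prod {b : ℕ → ℝ} {N : ℕ} (hpos : ∀ t, 0 < b t) (h0 : b 0 = 1)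
    (h : ∀ t ≤ N, b t ^ (t + 1) ≤ (t + 1 : ℝ) ^ (t + 1) * ∏ s ∈ range (t + 1), b s)
    (t : ℕ) (ht : t + 1 ≤ N) :
    b (t + 1) ≤ (t + 2 : ℝ) ^ 2 * (t + 1 : ℝ) ^ Real.log (t + 1) := by
  have h1 := log_le_of_pow_le_prod hpos h0 h (t + 1) ht
  have h2 := sum_log_div_le t
  push_cast at h1
  rw [show (t + 1 + 1 : ℝ) = t + 2 by ring] at h1
  rw [← Real.log_le_log_iff (hpos _) (by positivity), Real.log_mul (by positivity) (by positivity),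
    Real.log_pow, Real.log_rpow (by positivity)]
  push_cast
  nlinarith

theorem sum_le_etaBoostedKZ_sq {b : ℕ → ℝ} {N n : ℕ} (hN : N + 1 ≤ n) (hpos : ∀ t, 0 < b t)
    (h0 : b 0 = 1)
    (h : ∀ t ≤ N, b t ^ (t + 1) ≤ (t + 1 : ℝ) ^ (t + 1) * ∏ s ∈ range (t + 1), b s) :
    ∑ t ∈ range (N + 1), b t ≤ etaBoostedKZ n ^ 2 := by
  rw [etaBoostedKZ]
  split_ifs with hn
  · obtain rfl : N = 0 := by omega
    simp [h0]
  obtain ⟨M, rfl⟩ : ∃ M, n = M + 2 := ⟨n - 2, by omega⟩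
  have hcast : ((M + 2 : ℕ) : ℝ) - 1 = M + 1 := by push_cast; ring
  rw [hcast, sum_range_succ', h0, Real.rpow_add (by positivity), Real.rpow_one]
  set E : ℝ := (M + 1 : ℝ) ^ (Real.log (M + 1) / 2) with hE
  have hM1 : (1 : ℝ) ≤ M + 1 := by linarith [Nat.cast_nonneg (α := ℝ) M]
  have hEsq : (M + 1 : ℝ) ^ Real.log (M + 1) = E ^ 2 := by
    rw [hE, ← Real.rpow_natCast, ← Real.rpow_mul (by positivity)]
    norm_num
  have hterm : ∀ t ∈ range N, b (t + 1) ≤ (M + 2 : ℝ) ^ 2 * E ^ 2 := by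
    intro t ht
    have htN : t + 1 ≤ N := mem_range.mp ht
    have htM : (t : ℝ) ≤ M := by exact_mod_cast (by omega : t ≤ M)
    refine (le_of_pow_le_prod hpos h0 h t htN).trans ?_
    rw [← hEsq]
    have ht1 : (1 : ℝ) ≤ t + 1 := by linarith [Nat.cast_nonneg (α := ℝ) t]
    have hlog : Real.log (t + 1) ≤ Real.log (M + 1) := Real.log_le_log (by positivity) (by linarith)
    have : (t + 1 : ℝ) ^ Real.log (t + 1) ≤ (M + 1 : ℝ) ^ Real.log (M + 1) :=
      (Real.rpow_le_rpow_of_exponent_le ht1 hlog).trans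
        (Real.rpow_le_rpow (by positivity) (by linarith) (Real.log_nonneg hM1))
    gcongr
  have hsum := sum_le_card_nsmul _ _ _ hterm
  rw [card_range, nsmul_eq_mul] at hsum
  have hNM : (N : ℝ) ≤ M + 1 := by exact_mod_cast (by omega : N ≤ M + 1)
  have hsum' : ∑ t ∈ range N, b (t + 1) ≤ (M + 1) * ((M + 2 : ℝ) ^ 2 * E ^ 2) :=
    hsum.trans (by gcongr)
  have hE1 : 1 ≤ E := Real.one_le_rpow hM1 (by have := Real.log_nonneg hM1; positivity)
  push_cast
  rcases Nat.eq_zero_or_pos M with rfl | hMpos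
  -- For `n = 2` the factor `64 / 81 * (M + 1)` is below one, so the full square is needed: `1 + 4 ≤
  -- (25 / 9) ^ 2`.
  · have : E = 1 := by simp [hE]
    rw [this] at hsum' ⊢
    norm_num at hsum' ⊢
    linarith
  · have hM : (1 : ℝ) ≤ M := by exact_mod_cast hMpos
    have h1 : (M + 1 : ℝ) * ((M + 2 : ℝ) ^ 2 * E ^ 2) ≤
        (8 * (M + 2 : ℝ) / 9 * ((M + 1) * E)) ^ 2 := by
      have : (8 * (M + 2 : ℝ) / 9 * ((M + 1) * E)) ^ 2 =
          (64 / 81 * (M + 1)) * ((M + 1) * ((M + 2 : ℝ) ^ 2 * E ^ 2)) := by ring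
      rw [this]
      -- Here `M + 1 ≥ 2`, and `128 / 81 ≥ 1`.
      exact le_mul_of_one_le_left (by positivity) (by linarith)
    have h2 : 0 ≤ 8 * (M + 2 : ℝ) / 9 * ((M + 1) * E) := by positivity
    nlinarith

end

/-! ### Babai's argument for SIC -/

section

open Matrix

theorem sic_eq_round {m n : ℕ} (Q : Matrix (Fin m) (Fin n) ℝ) (R : Matrix (Fin n) (Fin n) ℝ)
    (y : EuclideanSpace ℝ (Fin m)) (k : Fin n) :
    sic Q R y k = round (((Qᵀ *ᵥ y.ofLp) k -
      ∑ j : {j : Fin n // k < j}, R k j.val * (sic Q R y j.val : ℝ)) / R k k) := by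
  rw [sic, sicCoord]
  rfl

/-- Babai's bound for back substitution with rounding. -/
theorem norm_sub_sic_le {m n : ℕ} {H Q : Matrix (Fin m) (Fin n) ℝ}
    {R : Matrix (Fin n) (Fin n) ℝ} (hQR : IsQR H Q R) (hdiag : ∀ k, R k k ≠ 0) {c : ℝ}
    (hc : 1 ≤ c) (hR : ∀ k, ∑ i ∈ Finset.Iic k, R i i ^ 2 ≤ c ^ 2 * R k k ^ 2)
    (y : EuclideanSpace ℝ (Fin m)) (x : Fin n → ℤ) :
    ‖y - latticePoint H (sic Q R y)‖ ≤ c * ‖y - latticePoint H x‖ := by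
  have hc2 : 1 ≤ c ^ 2 := one_le_pow₀ hc
  set r : (Fin n → ℤ) → Fin n → ℝ :=
    fun z k => (Qᵀ *ᵥ y.ofLp) k - (R *ᵥ fun i => (z i : ℝ)) k with hr
  have hres : ∀ z k, r z k = R k k * (((Qᵀ *ᵥ y.ofLp) k -
      ∑ j : {j : Fin n // k < j}, R k j.val * (z j.val : ℝ)) / R k k - z k) :=
    fun z k => sub_mulVec_eq_of_upper hQR.upper _ _ k (hdiag k)
  suffices hsum : ∑ k, r (sic Q R y) k ^ 2 ≤ c ^ 2 * ∑ k, r x k ^ 2 by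
    refine le_of_sq_le_sq ?_ (by positivity)
    rw [mul_pow, norm_sq_sub_latticePoint hQR, norm_sq_sub_latticePoint hQR, mul_add]
    -- The part of `y` orthogonal to the columns is common to both sides, and `c ≥ 1` absorbs it.
    exact add_le_add (le_mul_of_one_le_left (by positivity) hc2) hsum
  by_cases hx : x = sic Q R y
  · rw [← hx]
    exact le_mul_of_one_le_left (Finset.sum_nonneg fun _ _ => sq_nonneg _) hc2
  obtain ⟨k, hk, hmax⟩ : ∃ k, x k ≠ sic Q R y k ∧ ∀ j, k < j → x j = sic Q R y j := by
    have hne : (Finset.univ.filter fun k => x k ≠ sic Q R y k).Nonempty := by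
      obtain ⟨k, hk⟩ := Function.ne_iff.mp hx
      exact ⟨k, by simpa using hk⟩
    refine ⟨_, (Finset.mem_filter.mp (Finset.max'_mem _ hne)).2, fun j hj => ?_⟩
    by_contra h
    exact absurd (Finset.le_max' _ j (by simpa using h)) (not_le.mpr hj)
  have hsic : ∀ i, r (sic Q R y) i ^ 2 ≤ 1 / 4 * R i i ^ 2 := by
    intro i
    rw [hres, sic_eq_round Q R y i, mul_pow, mul_comm]
    gcongr
    rw [← sq_abs]
    calc _ ≤ (1 / 2 : ℝ) ^ 2 := pow_le_pow_left₀ (abs_nonneg _) (abs_sub_round _) 2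
      _ = _ := by norm_num
  -- Since `x` agrees with SIC above `k`, both choose an integer for the same real number, and `x k`
  -- is not its rounding.
  have hx_k : 1 / 4 * R k k ^ 2 ≤ r x k ^ 2 := by
    have hs : ∑ j : {j : Fin n // k < j}, R k j.val * (x j.val : ℝ) =
        ∑ j : {j : Fin n // k < j}, R k j.val * (sic Q R y j.val : ℝ) :=
      Finset.sum_congr rfl fun j _ => by rw [hmax j.val j.property]
    rw [hres, hs, mul_pow, mul_comm (R k k ^ 2)]
    rw [sic_eq_round Q R y k] at hk
    gcongr
    rw [← sq_abs]
    calc (1 / 4 : ℝ) = (1 / 2) ^ 2 := by norm_num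
      _ ≤ _ := pow_le_pow_left₀ (by norm_num) (half_le_abs_sub_of_ne_round hk) 2
  have htail : ∀ j ∈ Finset.Ioi k, r (sic Q R y) j ^ 2 = r x j ^ 2 := by
    intro j hj
    have hkj : k < j := Finset.mem_Ioi.mp hj
    have hs : ∑ l : {l : Fin n // j < l}, R j l.val * (x l.val : ℝ) =
        ∑ l : {l : Fin n // j < l}, R j l.val * (sic Q R y l.val : ℝ) :=
      Finset.sum_congr rfl fun l _ => by rw [hmax l.val (hkj.trans l.property)]
    rw [hres, hres, hs, hmax j hkj]
  have hsplit : ∀ f : Fin n → ℝ, ∑ i, f i = ∑ i ∈ Finset.Iic k, f i + ∑ i ∈ Finset.Ioi k, f i := by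
    intro f
    rw [← Finset.sum_filter_add_sum_filter_not Finset.univ (· ≤ k)]
    congr 2 <;> ext <;> simp
  rw [hsplit, hsplit (fun i => r x i ^ 2), Finset.sum_congr rfl htail, mul_add]
  refine add_le_add ?_ (le_mul_of_one_le_left (Finset.sum_nonneg fun _ _ => sq_nonneg _) hc2)
  calc ∑ i ∈ Finset.Iic k, r (sic Q R y) i ^ 2
      ≤ ∑ i ∈ Finset.Iic k, 1 / 4 * R i i ^ 2 := Finset.sum_le_sum fun i _ => hsic i
    _ = 1 / 4 * ∑ i ∈ Finset.Iic k, R i i ^ 2 := (Finset.mul_sum _ _ _).symm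
    _ ≤ 1 / 4 * (c ^ 2 * R k k ^ 2) := by gcongr; exact hR k
    _ = c ^ 2 * (1 / 4 * R k k ^ 2) := by ring
    _ ≤ c ^ 2 * r x k ^ 2 := by gcongr
    _ ≤ c ^ 2 * ∑ i ∈ Finset.Iic k, r x i ^ 2 := by
      gcongr
      exact Finset.single_le_sum (f := fun i => r x i ^ 2) (fun _ _ => sq_nonneg _)
        (Finset.mem_Iic.mpr le_rfl)

theorem solvesApproxCVP_sic {m n : ℕ} {H Q : Matrix (Fin m) (Fin n) ℝ}
    {R : Matrix (Fin n) (Fin n) ℝ} (hH : IsLatticeBasis H) (hQR : IsQR H Q R) {c : ℝ}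
    (hc : 1 ≤ c) (hR : ∀ k, ∑ i ∈ Finset.Iic k, R i i ^ 2 ≤ c ^ 2 * R k k ^ 2)
    (y : EuclideanSpace ℝ (Fin m)) : SolvesApproxCVP c H y (sic Q R y) :=
  ⟨exists_isCVP hH y, fun x _ => norm_sub_sic_le hQR (hQR.diag_ne_zero hH) hc hR y x⟩

/-! ### The LLL case -/

theorem sum_Iic_val_le_of_le_mul_succ {n : ℕ} {a : Fin n → ℝ} {q : ℝ} (hq : 0 ≤ q)
    (h : ∀ i j : Fin n, j.val = i.val + 1 → a i ≤ q * a j) (k : Fin n) :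
    ∑ i ∈ Finset.Iic k, a i ≤ (∑ t ∈ Finset.range (k.val + 1), q ^ t) * a k := by
  obtain ⟨k, hk⟩ := k
  induction k with
  | zero =>
    have : (Finset.Iic (⟨0, hk⟩ : Fin n)) = {⟨0, hk⟩} := by
      ext i; simp [Fin.le_def, Fin.ext_iff]
    simp [this]
  | succ k ih =>
    have hIic : Finset.Iic (⟨k + 1, hk⟩ : Fin n) =
        insert ⟨k + 1, hk⟩ (Finset.Iic (⟨k, by omega⟩ : Fin n)) := by
      ext i
      simp only [Finset.mem_Iic, Finset.mem_insert, Fin.le_def, Fin.ext_iff]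
      omega
    rw [hIic, Finset.sum_insert (by simp [Fin.le_def]), geom_sum_succ]
    have h1 := h ⟨k, by omega⟩ ⟨k + 1, hk⟩ rfl
    have hg : 0 ≤ ∑ t ∈ Finset.range (k + 1), q ^ t := Finset.sum_nonneg fun _ _ => by positivity
    have h2 := mul_le_mul_of_nonneg_left h1 hg
    have h3 := ih (by omega)
    simp only at h3 ⊢
    linarith

theorem one_lt_lovaszBeta_sq {δ : ℝ} (h1 : 1 / 4 < δ) (h2 : δ < 1) : 1 < lovaszBeta δ ^ 2 := by
  rw [lovaszBeta, div_pow, Real.sq_sqrt (by linarith), one_pow, lt_div_iff₀ (by linarith)]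
  linarith

/-- The rounded remainder in the Lovász condition is at most `|R i i| / 2`, so `(δ - 1/4) * R i i ^
2 ≤ R j j ^ 2`. -/
theorem IsBoostedLLL.diag_sq_le {m n p : ℕ} {δ : ℝ} {O : ApproxCVPOracle m p}
    {H : Matrix (Fin m) (Fin n) ℝ} {R : Matrix (Fin n) (Fin n) ℝ} (h : IsBoostedLLL δ O H R)
    (h1 : 1 / 4 < δ) (hdiag : ∀ k, R k k ≠ 0) (i j : Fin n) (hij : j.val = i.val + 1) :
    R i i ^ 2 ≤ lovaszBeta δ ^ 2 * R j j ^ 2 := by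
  have hd := h.diagonal i j hij
  have he : (R i j - (round (R i j / R i i) : ℝ) * R i i) ^ 2 ≤ 1 / 4 * R i i ^ 2 := by
    have : R i j - (round (R i j / R i i) : ℝ) * R i i =
        (R i j / R i i - round (R i j / R i i)) * R i i := by
      field_simp [hdiag i]
    rw [this, mul_pow]
    gcongr
    rw [← sq_abs]
    calc _ ≤ (1 / 2 : ℝ) ^ 2 := pow_le_pow_left₀ (abs_nonneg _) (abs_sub_round _) 2
      _ = _ := by norm_num
  rw [lovaszBeta, div_pow, Real.sq_sqrt (by linarith), one_pow, one_div_mul_eq_div,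
    le_div_iff₀ (by linarith)]
  linarith

theorem IsBoostedLLL.solvesApproxCVP_sic {m n p : ℕ} {δ : ℝ} {O : ApproxCVPOracle m p}
    {H Q : Matrix (Fin m) (Fin n) ℝ} {R : Matrix (Fin n) (Fin n) ℝ} (h : IsBoostedLLL δ O H R)
    (hn : 1 ≤ n) (h1 : 1 / 4 < δ) (h2 : δ < 1) (hH : IsLatticeBasis H) (hQR : IsQR H Q R)
    (y : EuclideanSpace ℝ (Fin m)) : SolvesApproxCVP (etaBoostedLLL δ n) H y (sic Q R y) := by
  have hdiag := hQR.diag_ne_zero hH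
  have hb := one_lt_lovaszBeta_sq h1 h2
  have hb0 : 0 ≤ lovaszBeta δ := by unfold lovaszBeta; positivity
  have hsq : etaBoostedLLL δ n ^ 2 = (lovaszBeta δ ^ 2) ^ n / (lovaszBeta δ ^ 2 - 1) := by
    rw [etaBoostedLLL, div_pow, Real.sq_sqrt (by linarith), ← pow_mul, ← pow_mul, mul_comm]
  have heta : 0 ≤ etaBoostedLLL δ n := by unfold etaBoostedLLL; positivity
  refine _root_.solvesApproxCVP_sic hH hQR ?_ (fun k => ?_) y
  · rw [← one_le_sq_iff₀ heta, hsq, le_div_iff₀ (by linarith)]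
    have := le_self_pow₀ hb.le (by omega : n ≠ 0)
    linarith
  · refine (sum_Iic_val_le_of_le_mul_succ (by positivity) (h.diag_sq_le h1 hdiag) k).trans ?_
    rw [hsq, geom_sum_eq hb.ne']
    gcongr
    have := pow_le_pow_right₀ hb.le (by omega : k.val + 1 ≤ n)
    linarith

end

/-! ### The KZ case -/

section

open Matrix

theorem column_eq_toLp_mulVec {m n : ℕ} {H Q : Matrix (Fin m) (Fin n) ℝ}
    {R : Matrix (Fin n) (Fin n) ℝ} (hQR : IsQR H Q R) (j : Fin n) :
    column H j = WithLp.toLp 2 (Q *ᵥ fun a => R a j) := by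
  ext a
  rw [hQR.factor]
  rfl

theorem toLp_mulVec_eq_sum {m n : ℕ} (Q : Matrix (Fin m) (Fin n) ℝ) (c : Fin n → ℝ) :
    WithLp.toLp 2 (Q *ᵥ c) = ∑ a, c a • column Q a := by
  ext b
  simp [column, mulVec, dotProduct, mul_comm]

/-- The span of the preceding columns of `H` contains the preceding columns of `Q`. -/
theorem column_mem_precedingSpan {m n : ℕ} {H Q : Matrix (Fin m) (Fin n) ℝ}
    {R : Matrix (Fin n) (Fin n) ℝ} (hQR : IsQR H Q R) (hdiag : ∀ k, R k k ≠ 0) (i : Fin n) :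
    ∀ a, a < i → column Q a ∈ precedingSpan H i := by
  intro a
  induction a using WellFoundedLT.induction with
  | ind a ih =>
    intro hai
    have hcol : column H a ∈ precedingSpan H i :=
      Submodule.subset_span ⟨⟨a.val, hai⟩, rfl⟩
    rw [column_eq_toLp_mulVec hQR, toLp_mulVec_eq_sum,
      ← Finset.add_sum_erase _ _ (Finset.mem_univ a)] at hcol
    have hrest : ∑ b ∈ Finset.univ.erase a, R b a • column Q b ∈ precedingSpan H i := by
      refine Submodule.sum_mem _ fun b hb => ?_
      rcases lt_or_gt_of_ne (Finset.ne_of_mem_erase hb) with hlt | hgt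
      · exact Submodule.smul_mem _ _ (ih b hlt (hlt.trans hai))
      · rw [hQR.upper b a hgt, zero_smul]
        exact Submodule.zero_mem _
    have hsmul := (Submodule.add_mem_iff_left _ hrest).mp hcol
    exact (Submodule.smul_mem_iff _ (hdiag a)).mp hsmul

/-- The columns of `Q` before `i` lie in the preceding span and the others are orthogonal to it, so
projecting deletes the coordinates before `i`. -/
theorem projectedColumn_eq {m n : ℕ} {H Q : Matrix (Fin m) (Fin n) ℝ}
    {R : Matrix (Fin n) (Fin n) ℝ} (hQR : IsQR H Q R) (hdiag : ∀ k, R k k ≠ 0) (i j : Fin n) :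
    projectedColumn H i j = WithLp.toLp 2 (Q *ᵥ fun a => if i ≤ a then R a j else 0) := by
  have hsplit : column H j = WithLp.toLp 2 (Q *ᵥ fun a => if i ≤ a then 0 else R a j) +
      WithLp.toLp 2 (Q *ᵥ fun a => if i ≤ a then R a j else 0) := by
    rw [column_eq_toLp_mulVec hQR, ← WithLp.toLp_add, ← mulVec_add]
    congr 2
    funext a
    by_cases h : i ≤ a <;> simp [h]
  have hlow : WithLp.toLp 2 (Q *ᵥ fun a => if i ≤ a then 0 else R a j) ∈ precedingSpan H i := by
    rw [toLp_mulVec_eq_sum]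
    refine Submodule.sum_mem _ fun a _ => ?_
    split_ifs with h
    · simp
    · exact Submodule.smul_mem _ _ (column_mem_precedingSpan hQR hdiag i a (not_le.mp h))
  have hhigh : WithLp.toLp 2 (Q *ᵥ fun a => if i ≤ a then R a j else 0) ∈
      (precedingSpan H i)ᗮ := by
    rw [precedingSpan, Submodule.mem_orthogonal]
    intro u hu
    induction hu using Submodule.span_induction with
    | zero => simp
    | add u v _ _ hu hv => rw [inner_add_left, hu, hv, add_zero]
    | smul c u _ hu => rw [inner_smul_left, hu, mul_zero]
    | mem u hu =>
      obtain ⟨l, rfl⟩ := hu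
      have hli : Fin.castLE i.isLt.le l < i := l.isLt
      rw [precedingColumns, column_eq_toLp_mulVec hQR, EuclideanSpace.inner_toLp_toLp,
        star_trivial, dotProduct_mulVec, ← mulVec_transpose, mulVec_mulVec, hQR.orthonormal,
        one_mulVec]
      refine Finset.sum_eq_zero fun a _ => ?_
      by_cases h : i ≤ a
      · simp [hQR.upper a _ (hli.trans_le h)]
      · simp [h]
  rw [projectedColumn, Submodule.starProjection_orthogonal_val,
    Submodule.eq_starProjection_of_mem_orthogonal' hlow hhigh hsplit, hsplit, add_sub_cancel_left]

theorem norm_sq_sum_smul_projectedColumn {m n : ℕ} {H Q : Matrix (Fin m) (Fin n) ℝ}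
    {R : Matrix (Fin n) (Fin n) ℝ} (hQR : IsQR H Q R) (hdiag : ∀ k, R k k ≠ 0) (i : Fin n)
    (x : Fin n → ℝ) :
    ‖∑ j, x j • projectedColumn H i j‖ ^ 2 = ∑ a ∈ Finset.Ici i, ((R *ᵥ x) a) ^ 2 := by
  have h : ∑ j, x j • projectedColumn H i j =
      WithLp.toLp 2 (Q *ᵥ fun a => if i ≤ a then (R *ᵥ x) a else 0) := by
    simp_rw [projectedColumn_eq hQR hdiag, ← WithLp.toLp_smul, ← mulVec_smul, ← WithLp.toLp_sum]
    rw [← mulVec_sum]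
    congr 2
    funext a
    by_cases h : i ≤ a <;> simp [h, mulVec, dotProduct, mul_comm]
  rw [h, norm_sq_toLp_mulVec hQR.orthonormal]
  have hf : (Finset.Ici i) = Finset.univ.filter (i ≤ ·) := by ext; simp
  rw [hf, Finset.sum_filter]
  refine Finset.sum_congr rfl fun a _ => ?_
  split_ifs <;> simp

theorem sum_smul_mem_latticeOf {m : ℕ} {n : ℕ} (i : Fin n)
    (v : Fin n → EuclideanSpace ℝ (Fin m)) (x : Fin n → ℤ) (hx : ∀ j, j < i → x j = 0) :
    ∑ j, (x j : ℝ) • v j ∈ latticeOf (fun j : {j : Fin n // i ≤ j} => v j.val) := by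
  refine Submodule.sum_mem _ fun j _ => ?_
  rcases lt_or_ge j i with h | h
  · simp [hx j h]
  · rw [Int.cast_smul_eq_zsmul]
    exact Submodule.smul_mem _ _ (Submodule.subset_span ⟨⟨j, h⟩, rfl⟩)

/-- The block inequality of KZ reduced bases, from Minkowski's linear forms theorem. -/
theorem IsBoostedKZ.diag_sq_pow_le {m n : ℕ} {H Q : Matrix (Fin m) (Fin n) ℝ}
    {R : Matrix (Fin n) (Fin n) ℝ} (h : IsBoostedKZ H) (hQR : IsQR H Q R)
    (hdiag : ∀ k, R k k ≠ 0) {i k : Fin n} (hik : i ≤ k) :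
    (R i i ^ 2) ^ (Finset.Icc i k).card ≤
      ((Finset.Icc i k).card : ℝ) ^ (Finset.Icc i k).card * ∏ j ∈ Finset.Icc i k, R j j ^ 2 := by
  set S := Finset.Icc i k with hS
  have hiS : i ∈ S := Finset.mem_Icc.mpr ⟨le_rfl, hik⟩
  have : Nonempty S := ⟨⟨i, hiS⟩⟩
  set B : Matrix S S ℝ := R.submatrix Subtype.val Subtype.val with hB
  have hBdet : B.det = ∏ j ∈ S, R j j := by
    have hBup : B.IsUpperTriangular := fun a b hab => hQR.upper _ _ hab
    rw [det_of_isUpperTriangular hBup]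
    exact Finset.prod_coe_sort S fun j => R j j
  have hBdet0 : B.det ≠ 0 := by
    rw [hBdet]; exact Finset.prod_ne_zero_iff.mpr fun j _ => hdiag j
  have hcard : Fintype.card S = S.card := Fintype.card_coe S
  have hcard0 : S.card ≠ 0 := Finset.card_ne_zero_of_mem hiS
  -- `c` is the geometric mean of the `|R j j|` over the block, the smallest value Minkowski's
  -- theorem admits.
  obtain ⟨c, hc, hcdet⟩ : ∃ c : ℝ, 0 ≤ c ∧ c ^ S.card = |B.det| :=
    ⟨|B.det| ^ ((S.card : ℝ)⁻¹), by positivity,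
      Real.rpow_inv_natCast_pow (abs_nonneg _) hcard0⟩
  obtain ⟨x, hx0, hx⟩ := exists_int_ne_zero_abs_mulVec_le hBdet0 hc (by rw [hcard, hcdet])
  set z : Fin n → ℤ := fun j => if hj : j ∈ S then x ⟨j, hj⟩ else 0 with hz
  have hzout : ∀ j, j ∉ S → z j = 0 := fun j hj => by simp [hz, hj]
  have hzin : ∀ j : S, z j = x j := fun j => by simp [hz]
  have hRz : ∀ a : S, (R *ᵥ fun j => (z j : ℝ)) a = (B *ᵥ fun j => (x j : ℝ)) a := by
    intro a
    simp only [mulVec, dotProduct, hB, submatrix_apply, ← hzin]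
    rw [Finset.sum_coe_sort S fun j => R a j * (z j : ℝ)]
    refine (Finset.sum_subset (Finset.subset_univ _) fun j _ hj => ?_).symm
    simp [hzout j hj]
  have hRz0 : ∀ a, k < a → (R *ᵥ fun j => (z j : ℝ)) a = 0 := by
    intro a ha
    rw [mulVec, dotProduct]
    refine Finset.sum_eq_zero fun j _ => ?_
    by_cases hj : j ∈ S
    · rw [hQR.upper a j ((Finset.mem_Icc.mp hj).2.trans_lt ha), zero_mul]
    · simp [hzout j hj]
  have hnorm : ‖∑ j, (z j : ℝ) • projectedColumn H i j‖ ^ 2 =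
      ∑ a : S, ((B *ᵥ fun j => (x j : ℝ)) a) ^ 2 := by
    rw [norm_sq_sum_smul_projectedColumn hQR hdiag]
    simp_rw [← hRz]
    rw [Finset.sum_coe_sort S fun a => ((R *ᵥ fun j => (z j : ℝ)) a) ^ 2]
    refine (Finset.sum_subset Finset.Icc_subset_Ici_self fun a ha haS => ?_).symm
    rw [hRz0 a, sq, zero_mul]
    by_contra hak
    exact haS (Finset.mem_Icc.mpr ⟨Finset.mem_Ici.mp ha, not_lt.mp hak⟩)
  have hne : ∑ j, (z j : ℝ) • projectedColumn H i j ≠ 0 := by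
    intro h0
    rw [h0, norm_zero, sq, zero_mul] at hnorm
    apply hx0
    have hBx : (B *ᵥ fun j => (x j : ℝ)) = 0 := by
      funext a
      have := (Finset.sum_eq_zero_iff_of_nonneg fun _ _ => sq_nonneg _).mp hnorm.symm a
        (Finset.mem_univ a)
      simpa using this
    have := eq_zero_of_mulVec_eq_zero hBdet0 hBx
    funext j
    have hj : (x j : ℝ) = 0 := congrFun this j
    exact_mod_cast hj
  have hself : ‖projectedColumn H i i‖ ^ 2 = R i i ^ 2 := by
    rw [projectedColumn_eq hQR hdiag, norm_sq_toLp_mulVec hQR.orthonormal, Finset.sum_eq_single i]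
    · simp
    · intro a _ hai
      split_ifs with hia
      · rw [hQR.upper a i (lt_of_le_of_ne hia hai.symm), sq, zero_mul]
      · simp
    · simp
  -- Minkowski's vector, extended by zero, is a nonzero point of the projected lattice, so it is no
  -- shorter than the projection of column `i`.
  have hmin := (h.projection i).2.2 _ (sum_smul_mem_latticeOf i (projectedColumn H i) z
    fun j hj => hzout j fun hjS => (Finset.mem_Icc.mp hjS).1.not_gt hj) hne
  have hle : R i i ^ 2 ≤ S.card * c ^ 2 := by
    rw [← hself]
    calc _ ≤ _ := pow_le_pow_left₀ (norm_nonneg _) hmin 2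
      _ = _ := hnorm
      _ ≤ ∑ _a : S, c ^ 2 := Finset.sum_le_sum fun a _ => sq_le_sq' (abs_le.mp (hx a)).1
          (abs_le.mp (hx a)).2
      _ = _ := by simp
  calc _ ≤ (S.card * c ^ 2) ^ S.card := pow_le_pow_left₀ (sq_nonneg _) hle _
    _ = (S.card : ℝ) ^ S.card * (c ^ S.card) ^ 2 := by ring
    _ = _ := by rw [hcdet, sq_abs, hBdet, Finset.prod_pow]

theorem Fin.prod_Icc_sub_eq_prod_range {n : ℕ} (f : Fin n → ℝ) (k : Fin n) (t : ℕ)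
    (ht : t ≤ k.val) :
    ∏ j ∈ Finset.Icc (⟨k.val - t, by omega⟩ : Fin n) k, f j =
      ∏ s ∈ Finset.range (t + 1), f ⟨k.val - s, by omega⟩ := by
  symm
  refine Finset.prod_bij (fun s _ => ⟨k.val - s, by omega⟩) ?_ ?_ ?_ ?_
  · intro s hs
    simp only [Finset.mem_range, Finset.mem_Icc, Fin.le_def] at hs ⊢
    omega
  · intro s hs s' hs' he
    simp only [Finset.mem_range, Fin.mk.injEq] at hs hs' he
    omega
  · intro j hj
    simp only [Finset.mem_Icc, Fin.le_def] at hj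
    exact ⟨k.val - j.val, by simp only [Finset.mem_range]; omega,
      Fin.ext (by simp only; omega)⟩
  · intros; rfl

theorem Fin.sum_Iic_eq_sum_range {n : ℕ} (f : Fin n → ℝ) (k : Fin n) :
    ∑ j ∈ Finset.Iic k, f j = ∑ s ∈ Finset.range (k.val + 1), f ⟨k.val - s, by omega⟩ := by
  symm
  refine Finset.sum_bij (fun s _ => ⟨k.val - s, by omega⟩) ?_ ?_ ?_ ?_
  · intro s hs
    simp [Fin.le_def]
  · intro s hs s' hs' he
    simp only [Finset.mem_range, Fin.mk.injEq] at hs hs' he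
    omega
  · intro j hj
    simp only [Finset.mem_Iic, Fin.le_def] at hj
    exact ⟨k.val - j.val, by simp only [Finset.mem_range]; omega,
      Fin.ext (by simp only; omega)⟩
  · intros; rfl

theorem one_le_etaBoostedKZ {n : ℕ} (hn : 1 ≤ n) : 1 ≤ etaBoostedKZ n := by
  rw [etaBoostedKZ]
  split_ifs
  · exact le_rfl
  · have h1 : (1 : ℝ) ≤ n := by exact_mod_cast hn
    have := Real.rpow_nonneg (by linarith : (0 : ℝ) ≤ n - 1) (1 + Real.log ((n : ℝ) - 1) / 2)
    linarith [show 0 ≤ 8 * (n : ℝ) / 9 * ((n : ℝ) - 1) ^ (1 + Real.log ((n : ℝ) - 1) / 2) by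
      positivity]

theorem IsBoostedKZ.solvesApproxCVP_sic {m n : ℕ} {H Q : Matrix (Fin m) (Fin n) ℝ}
    {R : Matrix (Fin n) (Fin n) ℝ} (h : IsBoostedKZ H) (hn : 1 ≤ n) (hH : IsLatticeBasis H)
    (hQR : IsQR H Q R) (y : EuclideanSpace ℝ (Fin m)) :
    SolvesApproxCVP (etaBoostedKZ n) H y (sic Q R y) := by
  have hdiag := hQR.diag_ne_zero hH
  refine _root_.solvesApproxCVP_sic hH hQR (one_le_etaBoostedKZ hn) (fun k => ?_) y
  have hpos : ∀ j, 0 < R j j ^ 2 := fun j => by have := hdiag j; positivity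
  -- The diagonal is read backwards from `k`. For `t > k` truncated subtraction repeats the first
  -- entry, which keeps `a` positive everywhere.
  set a : ℕ → ℝ := fun t => R ⟨k.val - t, by omega⟩ ⟨k.val - t, by omega⟩ ^ 2 with ha
  have ha0 : a 0 = R k k ^ 2 := rfl
  have hapos : ∀ t, 0 < a t := fun t => hpos _
  have hblock : ∀ t ≤ k.val, (a t / a 0) ^ (t + 1) ≤
      (t + 1 : ℝ) ^ (t + 1) * ∏ s ∈ Finset.range (t + 1), a s / a 0 := by
    intro t ht
    have hik : (⟨k.val - t, by omega⟩ : Fin n) ≤ k := by simp [Fin.le_def]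
    have hcard : (Finset.Icc (⟨k.val - t, by omega⟩ : Fin n) k).card = t + 1 := by
      rw [Fin.card_Icc]; simp only; omega
    have hb := h.diag_sq_pow_le hQR hdiag hik
    rw [hcard, Fin.prod_Icc_sub_eq_prod_range (fun j => R j j ^ 2) k t ht] at hb
    rw [Finset.prod_div_distrib, Finset.prod_const, Finset.card_range, div_pow, ← mul_div_assoc]
    have := hapos 0
    gcongr
    exact_mod_cast hb
  have hsum := sum_le_etaBoostedKZ_sq (n := n) (N := k.val) (by omega)
    (fun t => div_pos (hapos t) (hapos 0)) (div_self (hapos 0).ne') hblock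
  rw [← Finset.sum_div, div_le_iff₀ (hapos 0)] at hsum
  rw [Fin.sum_Iic_eq_sum_range (fun j => R j j ^ 2)]
  exact hsum

end

theorem theorem1 (m n : ℕ) (hn : 1 ≤ n)
    (H Q : Matrix (Fin m) (Fin n) ℝ) (R : Matrix (Fin n) (Fin n) ℝ)
    (hH : IsLatticeBasis H) (hQR : IsQR H Q R) (y : EuclideanSpace ℝ (Fin m)) :
    (∀ (δ : ℝ) (p : ℕ) (O : ApproxCVPOracle m p), 1 / 4 < δ → δ < 1 → IsBoostedLLL δ O H R →
      SolvesApproxCVP (etaBoostedLLL δ n) H y (sic Q R y)) ∧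
    (IsBoostedKZ H → SolvesApproxCVP (etaBoostedKZ n) H y (sic Q R y)) :=
  ⟨fun _ _ _ h1 h2 h => h.solvesApproxCVP_sic hn h1 h2 hH hQR y,
    fun h => h.solvesApproxCVP_sic hn hH hQR y⟩
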